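/- All C$^*$-algebras are assumed to be unital. For a C$^*$-algebra $A$, let $A^{**}$ denote its double dual, regarded as a C$^*$-algebra (the enveloping von Neumann algebra $\pi_u(A)''$ of $A$, where $\pi_u$ is the universal representation) in which $A$ is canonically embedded. A C$^*$-subalgebra $A$ of a C$^*$-algebra $B$ is called \emph{relatively weakly injective} in $B$ if there is a unital completely positive (u.c.p.) map $\phi : B \to A^{**}$ with $\phi(a) = a$ for all $a \in A$. For an ultrafilter $\omega$ on a set $I$, the ultrapower of $A$ is the C$^*$-algebra $$A^\omega = \ell^\infty(I, A)\big/\{(a_i)_{i\in I} : \lim_{i \to \omega} \|a_i\| = 0\},$$ and the diagonal embedding $A \to A^\omega$ sends $a$ to the class of the constant family $(a)_{i \in I}$. \textbf{Proposition.} Let $A$ be a C$^*$-algebra and let $\omega$ be a nonprincipal ultrafilter on some (possibly uncountable) index set. (1) Suppose that $A$ is a C$^*$-subalgebra of a C$^*$-algebra $B$ and that there is a u.c.p. map $B \to A^\omega$ whose restriction to $A$ is the diagonal embedding of $A$. Then $A$ is relatively weakly injective in $B$. (2) $A$, regarded as a subalgebra of $A^\omega$ through the diagonal embedding, is relatively weakly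 injective in $A^\omega$. -/

import Mathlib

open Filter Topology
open scoped ENNReal ComplexOrder InnerProductSpace CStarAlgebra

/-! ### Ultrapowers of C⋆-algebras -/

section Ultrapower

/-- The bounded families `(xᵢ)` in `A` with `lim_ω ‖xᵢ‖ = 0`. -/
def ultraNull {ι : Type*} (A : Type*) [CStarAlgebra A] (ω : Ultrafilter ι) :
    Submodule ℂ (lp (fun _ : ι => A) ∞) where
  carrier := {x | Tendsto (fun i => ‖x i‖) ω (𝓝 0)}
  zero_mem' := by simp
  add_mem' {x y} hx hy := by
    refine squeeze_zero (fun _ => norm_nonneg _) (fun i => ?_)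
      (by simpa using Tendsto.add hx hy)
    simpa using norm_add_le (x i) (y i)
  smul_mem' c x hx := by
    have := Tendsto.const_mul ‖c‖ hx
    simpa [norm_smul] using this

/-- The C⋆-algebra ultrapower `A^ω = ℓ^∞(ι, A) / {x | lim_ω ‖xᵢ‖ = 0}`; the norm is the
quotient norm, which equals `lim_ω ‖xᵢ‖`. -/
def Ultrapower {ι : Type*} (A : Type*) [CStarAlgebra A] (ω : Ultrafilter ι) : Type _ :=
  lp (fun _ : ι => A) ∞ ⧸ ultraNull A ω

namespace Ultrapower

variable {ι : Type*} {A : Type*} [CStarAlgebra A] {ω : Ultrafilter ι}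

theorem isClosed_ultraNull : IsClosed (ultraNull A ω : Set (lp (fun _ : ι => A) ∞)) := by
  refine isClosed_of_closure_subset fun x hx => ?_
  change Tendsto (fun i => ‖x i‖) ω (𝓝 0)
  rw [Metric.tendsto_nhds]
  intro ε hε
  obtain ⟨y, hy, hxy⟩ := Metric.mem_closure_iff.1 hx (ε / 2) (by positivity)
  have hy' : Tendsto (fun i => ‖y i‖) ω (𝓝 0) := hy
  filter_upwards [hy'.eventually_lt_const (show (0 : ℝ) < ε / 2 by positivity)] with i hi
  have h1 : ‖(x - y) i‖ ≤ ‖x - y‖ := lp.norm_apply_le_norm ENNReal.top_ne_zero _ i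
  have h2 : ‖x i‖ ≤ ‖(x - y) i‖ + ‖y i‖ := by
    simpa using norm_add_le ((x - y) i) (y i)
  rw [dist_eq_norm] at hxy
  simpa using (by linarith : ‖x i‖ < ε)

noncomputable instance : NormedAddCommGroup (Ultrapower A ω) :=
  haveI : IsClosed (ultraNull A ω : Set (lp (fun _ : ι => A) ∞)) := isClosed_ultraNull
  inferInstanceAs (NormedAddCommGroup (lp (fun _ : ι => A) ∞ ⧸ ultraNull A ω))

noncomputable instance : NormedSpace ℂ (Ultrapower A ω) :=
  inferInstanceAs (NormedSpace ℂ (lp (fun _ : ι => A) ∞ ⧸ ultraNull A ω))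

instance : CompleteSpace (Ultrapower A ω) :=
  inferInstanceAs (CompleteSpace (lp (fun _ : ι => A) ∞ ⧸ ultraNull A ω))

/-- The class in `A^ω` of a bounded family. -/
noncomputable def mk (A : Type*) [CStarAlgebra A] (ω : Ultrafilter ι) :
    lp (fun _ : ι => A) ∞ →ₗ[ℂ] Ultrapower A ω :=
  (ultraNull A ω).mkQ

theorem mk_surjective : Function.Surjective (mk A ω) :=
  Submodule.mkQ_surjective _

theorem mk_eq_mk {x y : lp (fun _ : ι => A) ∞} :
    mk A ω x = mk A ω y ↔ Tendsto (fun i => ‖x i - y i‖) ω (𝓝 0) :=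
  Submodule.Quotient.eq (ultraNull A ω)

theorem tendsto_norm_mk (x : lp (fun _ : ι => A) ∞) :
    Tendsto (fun i => ‖x i‖) ω (𝓝 ‖mk A ω x‖) := by
  classical
  rw [Metric.tendsto_nhds]
  intro ε hε
  have hup : ∀ᶠ i in (ω : Filter ι), ‖x i‖ < ‖mk A ω x‖ + ε := by
    obtain ⟨m, hm, hmlt⟩ := QuotientAddGroup.exists_norm_mk_lt
      (S := (ultraNull A ω).toAddSubgroup) (mk A ω x) (half_pos hε)
    have hmx : mk A ω x = mk A ω m := hm.symm
    filter_upwards [(mk_eq_mk.1 hmx).eventually_lt_const (half_pos hε)] with i hi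
    have h1 : ‖m i‖ ≤ ‖m‖ := lp.norm_apply_le_norm ENNReal.top_ne_zero _ i
    have h2 : ‖x i‖ ≤ ‖x i - m i‖ + ‖m i‖ := by
      simpa using norm_add_le (x i - m i) (m i)
    have h3 : ‖m‖ < ‖mk A ω x‖ + ε / 2 := hmlt
    linarith
  have hlo : ∀ᶠ i in (ω : Filter ι), ‖mk A ω x‖ - ε < ‖x i‖ := by
    by_contra hcon
    rw [← Ultrafilter.eventually_not] at hcon
    simp only [not_lt] at hcon
    obtain ⟨i₀, hi₀⟩ := hcon.exists
    have hC : 0 ≤ ‖mk A ω x‖ - ε := (norm_nonneg _).trans hi₀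
    let y : lp (fun _ : ι => A) ∞ :=
      ⟨fun i => if ‖x i‖ ≤ ‖mk A ω x‖ - ε then x i else 0,
        memℓp_infty ⟨‖mk A ω x‖ - ε, by
          rintro _ ⟨i, rfl⟩
          by_cases h : ‖x i‖ ≤ ‖mk A ω x‖ - ε <;> simp only [h, if_true, if_false, norm_zero, hC]⟩⟩
    have hy : ‖y‖ ≤ ‖mk A ω x‖ - ε := by
      refine lp.norm_le_of_forall_le hC fun i => ?_
      change ‖(if ‖x i‖ ≤ ‖mk A ω x‖ - ε then x i else 0)‖ ≤ _
      split_ifs with h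
      · exact h
      · simpa using hC
    have hxy : mk A ω x = mk A ω y := by
      refine mk_eq_mk.2 (tendsto_const_nhds.congr' ?_)
      filter_upwards [hcon] with i hi
      change 0 = ‖x i - (if ‖x i‖ ≤ ‖mk A ω x‖ - ε then x i else 0)‖
      simp [hi]
    have : ‖mk A ω y‖ ≤ ‖y‖ := Submodule.Quotient.norm_mk_le (ultraNull A ω) y
    rw [← hxy] at this
    linarith
  filter_upwards [hup, hlo] with i h1 h2
  rw [Real.dist_eq, abs_lt]
  constructor <;> linarith

theorem bdd (x : lp (fun _ : ι => A) ∞) (i : ι) : ‖x i‖ ≤ ‖x‖ :=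
  lp.norm_apply_le_norm ENNReal.top_ne_zero x i

theorem mk_mul_congr {x x' y y' : lp (fun _ : ι => A) ∞}
    (hx : mk A ω x = mk A ω x') (hy : mk A ω y = mk A ω y') : mk A ω (x * y) = mk A ω (x' * y') := by
  rw [mk_eq_mk] at hx hy ⊢
  refine squeeze_zero (g := fun i => ‖x i - x' i‖ * ‖y‖ + ‖x'‖ * ‖y i - y' i‖)
    (fun _ => norm_nonneg _) (fun i => ?_)
    (by simpa using (hx.mul_const ‖y‖).add (hy.const_mul ‖x'‖))
  calc ‖x i * y i - x' i * y' i‖ = ‖(x i - x' i) * y i + x' i * (y i - y' i)‖ := by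
        congr 1; noncomm_ring
    _ ≤ ‖(x i - x' i) * y i‖ + ‖x' i * (y i - y' i)‖ := norm_add_le _ _
    _ ≤ ‖x i - x' i‖ * ‖y i‖ + ‖x' i‖ * ‖y i - y' i‖ :=
        add_le_add (norm_mul_le _ _) (norm_mul_le _ _)
    _ ≤ _ := by gcongr <;> exact bdd _ i

theorem mk_star_congr {x x' : lp (fun _ : ι => A) ∞}
    (hx : mk A ω x = mk A ω x') : mk A ω (star x) = mk A ω (star x') := by
  rw [mk_eq_mk] at hx ⊢
  refine hx.congr fun i => ?_
  rw [lp.star_apply, lp.star_apply, ← star_sub, norm_star]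

/-- The constant family with value `a`. -/
def const (ι : Type*) (a : A) : lp (fun _ : ι => A) ∞ :=
  ⟨fun _ => a, memℓp_infty ⟨‖a‖, by rintro _ ⟨i, rfl⟩; exact le_rfl⟩⟩

theorem const_apply (a : A) (i : ι) : const ι a i = a := rfl

noncomputable instance : One (Ultrapower A ω) := ⟨mk A ω (const ι 1)⟩

/-- Multiplication in `A^ω` is computed on representatives. -/
noncomputable instance : Mul (Ultrapower A ω) :=
  ⟨Quotient.map₂ (fun x y => x * y) fun _ _ hx _ _ hy =>
    Quotient.exact (mk_mul_congr (Quotient.sound hx) (Quotient.sound hy))⟩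

/-- The involution of `A^ω` is computed on representatives. -/
noncomputable instance : Star (Ultrapower A ω) :=
  ⟨Quotient.map (fun x => star x) fun _ _ hx => Quotient.exact (mk_star_congr (Quotient.sound hx))⟩

theorem mk_mul (x y : lp (fun _ : ι => A) ∞) : mk A ω (x * y) = mk A ω x * mk A ω y := rfl

theorem mk_star (x : lp (fun _ : ι => A) ∞) : mk A ω (star x) = star (mk A ω x) := rfl

theorem one_def : (1 : Ultrapower A ω) = mk A ω (const ι 1) := rfl

noncomputable instance : NormedRing (Ultrapower A ω) :=
  { (inferInstance : NormedAddCommGroup (Ultrapower A ω)) with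
    mul := (· * ·)
    one := 1
    mul_assoc := fun a b c => by
      obtain ⟨x, rfl⟩ := mk_surjective a
      obtain ⟨y, rfl⟩ := mk_surjective b
      obtain ⟨z, rfl⟩ := mk_surjective c
      simp only [← mk_mul, mul_assoc]
    left_distrib := fun a b c => by
      obtain ⟨x, rfl⟩ := mk_surjective a
      obtain ⟨y, rfl⟩ := mk_surjective b
      obtain ⟨z, rfl⟩ := mk_surjective c
      simp only [← mk_mul, ← map_add, mul_add]
    right_distrib := fun a b c => by
      obtain ⟨x, rfl⟩ := mk_surjective a
      obtain ⟨y, rfl⟩ := mk_surjective b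
      obtain ⟨z, rfl⟩ := mk_surjective c
      simp only [← mk_mul, ← map_add, add_mul]
    zero_mul := fun a => by
      obtain ⟨x, rfl⟩ := mk_surjective a
      rw [← map_zero (mk A ω), ← mk_mul, zero_mul]
    mul_zero := fun a => by
      obtain ⟨x, rfl⟩ := mk_surjective a
      rw [← map_zero (mk A ω), ← mk_mul, mul_zero]
    one_mul := fun a => by
      obtain ⟨x, rfl⟩ := mk_surjective a
      rw [one_def, ← mk_mul]
      congr 1
      ext i
      simp [const_apply]
    mul_one := fun a => by
      obtain ⟨x, rfl⟩ := mk_surjective a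
      rw [one_def, ← mk_mul]
      congr 1
      ext i
      simp [const_apply]
    norm_mul_le := fun a b => by
      obtain ⟨x, rfl⟩ := mk_surjective a
      obtain ⟨y, rfl⟩ := mk_surjective b
      rw [← mk_mul]
      exact le_of_tendsto_of_tendsto' (tendsto_norm_mk (x * y))
        ((tendsto_norm_mk x).mul (tendsto_norm_mk y)) fun i => norm_mul_le (x i) (y i) }

noncomputable instance : NormedAlgebra ℂ (Ultrapower A ω) :=
  { Algebra.ofModule
      (fun r a b => by
        obtain ⟨x, rfl⟩ := mk_surjective a
        obtain ⟨y, rfl⟩ := mk_surjective b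
        rw [← mk_mul, ← map_smul, ← map_smul, ← mk_mul, smul_mul_assoc])
      (fun r a b => by
        obtain ⟨x, rfl⟩ := mk_surjective a
        obtain ⟨y, rfl⟩ := mk_surjective b
        rw [← mk_mul, ← map_smul, ← map_smul, ← mk_mul, mul_smul_comm]) with
    norm_smul_le := fun r a => norm_smul_le r a }

noncomputable instance : StarRing (Ultrapower A ω) where
  star_involutive a := by
    obtain ⟨x, rfl⟩ := mk_surjective a
    rw [← mk_star, ← mk_star, star_star]
  star_mul a b := by
    obtain ⟨x, rfl⟩ := mk_surjective a
    obtain ⟨y, rfl⟩ := mk_surjective b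
    rw [← mk_star, ← mk_star, ← mk_mul, ← mk_mul, ← mk_star, star_mul]
  star_add a b := by
    obtain ⟨x, rfl⟩ := mk_surjective a
    obtain ⟨y, rfl⟩ := mk_surjective b
    rw [← mk_star, ← mk_star, ← map_add, ← map_add, ← mk_star, star_add]

noncomputable instance : CStarAlgebra (Ultrapower A ω) where
  norm_mul_self_le a := by
    obtain ⟨x, rfl⟩ := mk_surjective a
    rw [← mk_star, ← mk_mul]
    exact le_of_tendsto_of_tendsto' ((tendsto_norm_mk x).mul (tendsto_norm_mk x))
      (tendsto_norm_mk (star x * x)) fun i => CStarRing.norm_star_mul_self (x := x i).symm.le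
  star_smul r a := by
    obtain ⟨x, rfl⟩ := mk_surjective a
    rw [← map_smul, ← mk_star, ← mk_star, ← map_smul, star_smul]

/-- The order of the C⋆-algebra `A^ω`. -/
noncomputable instance : PartialOrder (Ultrapower A ω) := CStarAlgebra.spectralOrder _

instance : StarOrderedRing (Ultrapower A ω) := CStarAlgebra.spectralOrderedRing _

/-- The diagonal embedding `A → A^ω`, `a ↦ [(a)ᵢ]`. -/
noncomputable def diagonal (A : Type*) [CStarAlgebra A] (ω : Ultrafilter ι) :
    A →⋆ₐ[ℂ] Ultrapower A ω where
  toFun a := mk A ω (const ι a)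
  map_one' := rfl
  map_mul' _ _ := rfl
  map_zero' := rfl
  map_add' _ _ := rfl
  commutes' r := by
    rw [Algebra.algebraMap_eq_smul_one, Algebra.algebraMap_eq_smul_one, one_def, ← map_smul]
    rfl
  map_star' _ := rfl

end Ultrapower

end Ultrapower

/-! ### The double dual `A**`, as the enveloping von Neumann algebra -/

section DoubleDual

variable (A : Type*) [CStarAlgebra A] [PartialOrder A] [StarOrderedRing A]

/-- The states of `A`. -/
def StateOf : Type _ := {f : A →ₚ[ℂ] ℂ // f 1 = 1}

/-- The Hilbert space of the universal representation: the `ℓ²`-direct sum of the GNS spaces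
of all states of `A`. -/
abbrev UniversalHilbert : Type _ := lp (fun f : StateOf A => f.1.GNS) 2

variable {A}

theorem gns_apply_norm_le (a : A) (x : UniversalHilbert A) (f : StateOf A) :
    ‖f.1.gnsStarAlgHom a (x f)‖ ≤ ‖((‖a‖ : ℂ) • x) f‖ := by
  rw [lp.coeFn_smul, Pi.smul_apply, norm_smul, Complex.norm_real, norm_norm]
  exact (ContinuousLinearMap.le_opNorm _ _).trans <|
    mul_le_mul_of_nonneg_right (NonUnitalStarAlgHom.norm_apply_le _ a) (norm_nonneg _)

/-- The operator `⊕_f π_f(a)`. -/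
noncomputable def universalOp (a : A) : UniversalHilbert A →L[ℂ] UniversalHilbert A :=
  LinearMap.mkContinuous
    { toFun := fun x => ⟨fun f => f.1.gnsStarAlgHom a (x f),
        (lp.memℓp ((‖a‖ : ℂ) • x)).mono' (gns_apply_norm_le a x)⟩
      map_add' := fun x y => by ext f; exact map_add (f.1.gnsStarAlgHom a) (x f) (y f)
      map_smul' := fun c x => by ext f; exact map_smul (f.1.gnsStarAlgHom a) c (x f) }
    ‖a‖ fun x => by
      refine (lp.norm_mono two_ne_zero (gns_apply_norm_le a x)).trans ?_
      rw [norm_smul, Complex.norm_real, norm_norm]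

theorem universalOp_apply (a : A) (x : UniversalHilbert A) (f : StateOf A) :
    universalOp a x f = f.1.gnsStarAlgHom a (x f) := rfl

variable (A) in
/-- The universal representation `π_u = ⊕_f π_f` of `A`. -/
noncomputable def universalRep : A →⋆ₐ[ℂ] (UniversalHilbert A →L[ℂ] UniversalHilbert A) where
  toFun := universalOp
  map_one' := by ext x f; rw [universalOp_apply, map_one]; rfl
  map_mul' a b := by ext x f; rw [universalOp_apply, map_mul]; rfl
  map_zero' := by ext x f; rw [universalOp_apply, map_zero]; rfl
  map_add' a b := by ext x f; rw [universalOp_apply, map_add]; rfl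
  commutes' r := by
    ext x f
    rw [universalOp_apply, AlgHomClass.commutes, Algebra.algebraMap_eq_smul_one,
      Algebra.algebraMap_eq_smul_one]
    rfl
  map_star' a := by
    rw [ContinuousLinearMap.star_eq_adjoint, ContinuousLinearMap.eq_adjoint_iff]
    intro x y
    rw [lp.inner_eq_tsum, lp.inner_eq_tsum]
    refine tsum_congr fun f => ?_
    rw [universalOp_apply, universalOp_apply, map_star, ContinuousLinearMap.star_eq_adjoint,
      ContinuousLinearMap.adjoint_inner_left]

variable (A) in
/-- The enveloping von Neumann algebra `π_u(A)''` of `A`: the double commutant of the image of the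
universal representation. -/
noncomputable def envelopingVonNeumannAlgebra : VonNeumannAlgebra (UniversalHilbert A) where
  toStarSubalgebra := StarSubalgebra.centralizer ℂ
    (StarSubalgebra.centralizer ℂ (Set.range (universalRep A)) :
      Set (UniversalHilbert A →L[ℂ] UniversalHilbert A))
  centralizer_centralizer' := by
    change Set.centralizer (Set.centralizer (Set.centralizer _)) = Set.centralizer _
    exact Set.centralizer_centralizer_centralizer _

variable (A) in
/-- The double dual `A**` of `A` as a (unital) C⋆-algebra, i.e. the enveloping von Neumann algebra
`π_u(A)''`, which is the standard realisation of the Banach space bidual of `A` as a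
von Neumann algebra (Sherman-Takeda). -/
abbrev DoubleDual : Type _ := (envelopingVonNeumannAlgebra A).toStarSubalgebra

theorem isClosed_vonNeumannAlgebra {H : Type*} [NormedAddCommGroup H] [InnerProductSpace ℂ H]
    [CompleteSpace H] (S : VonNeumannAlgebra H) :
    IsClosed (S.toStarSubalgebra : Set (H →L[ℂ] H)) := by
  rw [VonNeumannAlgebra.coe_toStarSubalgebra, ← S.centralizer_centralizer]
  exact Set.isClosed_centralizer _

namespace DoubleDual

instance : IsClosed ((envelopingVonNeumannAlgebra A).toStarSubalgebra :
    Set (UniversalHilbert A →L[ℂ] UniversalHilbert A)) :=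
  isClosed_vonNeumannAlgebra _

/-- The order of the C⋆-algebra `A**`. -/
noncomputable instance : PartialOrder (DoubleDual A) := CStarAlgebra.spectralOrder _

instance : StarOrderedRing (DoubleDual A) := CStarAlgebra.spectralOrderedRing _

theorem universalRep_mem (a : A) :
    universalRep A a ∈ (envelopingVonNeumannAlgebra A).toStarSubalgebra :=
  StarAlgebra.adjoin_le_centralizer_centralizer ℂ _
    (StarAlgebra.subset_adjoin ℂ _ ⟨a, rfl⟩)

variable (A) in
/-- The canonical embedding of `A` in its double dual. -/
noncomputable def inclusion : A →⋆ₐ[ℂ] DoubleDual A :=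
  (universalRep A).codRestrict _ universalRep_mem

end DoubleDual

end DoubleDual

/-! ### Relative weak injectivity -/

section RelativelyWeaklyInjective

variable {A B C : Type*} [CStarAlgebra A] [PartialOrder A] [StarOrderedRing A]
  [CStarAlgebra B] [PartialOrder B] [StarOrderedRing B]
  [CStarAlgebra C] [PartialOrder C] [StarOrderedRing C]

/-- A completely positive map is u.c.p. if it is in addition unital. -/
def IsUCP (φ : B →CP C) : Prop := φ 1 = 1

/-- `A`, regarded as a C⋆-subalgebra of `B` through the injective ⋆-homomorphism `j`, is relatively
weakly injective in `B`: there is a weak conditional expectation, that is, a u.c.p. map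
`φ : B → A**` which is the identity on `A`. -/
def RelativelyWeaklyInjective (j : A →⋆ₙₐ[ℂ] B) : Prop :=
  ∃ φ : B →CP DoubleDual A, IsUCP φ ∧ ∀ a : A, φ (j a) = DoubleDual.inclusion A a

end RelativelyWeaklyInjective

/-!
A bounded family of operators converges along an ultrafilter in the weak operator topology. For the
images of the members of `ℓ^∞(ι, A)` under the universal representation the limits lie in the
enveloping von Neumann algebra `A**`, and the limit is unchanged when a null family is added, so
there is a linear map `A^ω → A**` whose composition with the diagonal embedding is the inclusion of
`A`. It is completely positive: a positive matrix over `A^ω` lifts to a family of positive matrices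
over `A`, and positivity of a matrix `M` of operators, that is, of all the elements
`∑ᵢⱼ vᵢ⋆ Mᵢⱼ vⱼ`, passes to weak operator limits. This gives (2), and composing with a u.c.p. map
`B → A^ω` gives (1).
-/

section Positivity

variable {E : Type*} [NonUnitalCStarAlgebra E]

theorem eq_zero_of_mul_mul_self_eq_zero {x : E} (hx : IsSelfAdjoint x) (h : x * x * x = 0) :
    x = 0 := by
  have h_sq : x * x = 0 := by
    rw [← CStarRing.star_mul_self_eq_zero_iff, star_mul, hx.star_eq, ← mul_assoc, h, zero_mul]
  rwa [← CStarRing.star_mul_self_eq_zero_iff, hx.star_eq]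

variable [PartialOrder E] [StarOrderedRing E]

-- Instance search fails for `CStarAlgebra.nonneg_iff_eq_star_mul_self` at `CStarMatrix n n E`,
-- where the real scalar action is not found to be compatible with multiplication.
theorem exists_eq_star_mul_self_of_nonneg {x : E} (hx : 0 ≤ x) : ∃ y : E, x = star y * y :=
  CStarAlgebra.nonneg_iff_eq_star_mul_self.1 hx

theorem nonneg_of_forall_conjugate_eq_zero {x : E} (hx : IsSelfAdjoint x)
    (h : ∀ p : E, 0 ≤ p → p * x * p ≤ 0 → p * x * p = 0) : 0 ≤ x := by
  have h_neg : 0 ≤ x⁻ := CFC.negPart_nonneg x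
  have h_conj : x⁻ * x * x⁻ = -(x⁻ * x⁻ * x⁻) := by
    nth_rw 2 [← CFC.posPart_sub_negPart x hx]
    rw [mul_sub, CFC.negPart_mul_posPart, zero_sub, neg_mul]
  have h_zero := h x⁻ h_neg <| by
    rw [h_conj, neg_nonpos]
    exact h_neg.isSelfAdjoint.conjugate_nonneg h_neg
  rw [h_conj, neg_eq_zero] at h_zero
  exact (CFC.negPart_eq_zero_iff x hx).1
    (eq_zero_of_mul_mul_self_eq_zero h_neg.isSelfAdjoint h_zero)

theorem nonneg_of_map_nonneg {F : Type*} [NonUnitalCStarAlgebra F] [PartialOrder F]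
    [StarOrderedRing F] (f : E →⋆ₙₐ[ℂ] F) (hf : Function.Injective f) {x : E} (hx : 0 ≤ f x) :
    0 ≤ x := by
  have hx_sa : IsSelfAdjoint x := hf ((map_star f x).trans hx.isSelfAdjoint.star_eq)
  refine nonneg_of_forall_conjugate_eq_zero hx_sa fun p hp h_nonpos =>
    hf (le_antisymm (OrderHomClass.mono f h_nonpos) ?_)
  rw [map_zero, map_mul, map_mul]
  exact (hp.isSelfAdjoint.map f).conjugate_nonneg hx

end Positivity

section QuadraticForm

variable {n E : Type*} [Fintype n] [NonUnitalCStarAlgebra E]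

/-- The quadratic form `M ↦ v⋆ M v` of matrices over a C⋆-algebra `E`, for a fixed column `v` with
entries in `E`. It takes values in `E` and detects positivity of matrices. -/
def matrixQuadForm (v : n → E) : CStarMatrix n n E →ₗ[ℂ] E where
  toFun M := ∑ i, ∑ j, star (v i) * M i j * v j
  map_add' M N := by simp only [CStarMatrix.add_apply, mul_add, add_mul, Finset.sum_add_distrib]
  map_smul' c M := by
    simp only [CStarMatrix.smul_apply, mul_smul_comm, smul_mul_assoc, Finset.smul_sum,
      RingHom.id_apply]

theorem matrixQuadForm_apply (v : n → E) (M : CStarMatrix n n E) :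
    matrixQuadForm v M = ∑ i, ∑ j, star (v i) * M i j * v j := rfl

theorem matrixQuadForm_star (v : n → E) (M : CStarMatrix n n E) :
    matrixQuadForm v (star M) = star (matrixQuadForm v M) := by
  simp only [matrixQuadForm_apply, star_sum, star_mul, star_star, CStarMatrix.star_apply, mul_assoc]
  exact Finset.sum_comm

theorem matrixQuadForm_star_mul_self (v : n → E) (N : CStarMatrix n n E) :
    matrixQuadForm v (star N * N) = ∑ k, star (∑ i, N k i * v i) * ∑ i, N k i * v i := by
  simp only [matrixQuadForm_apply, CStarMatrix.mul_apply, CStarMatrix.star_apply,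
    Finset.sum_mul_sum, star_sum, star_mul, mul_assoc]
  simp only [Finset.mul_sum, Finset.sum_mul, mul_assoc]
  exact (Finset.sum_congr rfl fun i _ => Finset.sum_comm).trans Finset.sum_comm

theorem star_mul_mul_apply_self_eq_matrixQuadForm (N M : CStarMatrix n n E) (k : n) :
    (star N * M * N) k k = matrixQuadForm (fun i => N i k) M := by
  simp only [matrixQuadForm_apply, CStarMatrix.mul_apply, CStarMatrix.star_apply, Finset.sum_mul]
  exact Finset.sum_comm

theorem star_mul_self_apply_self (N : CStarMatrix n n E) (k : n) :
    (star N * N) k k = ∑ i, star (N i k) * N i k := by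
  simp only [CStarMatrix.mul_apply, CStarMatrix.star_apply]

variable [PartialOrder E] [StarOrderedRing E] {M : CStarMatrix n n E}

theorem matrixQuadForm_nonneg (hM : 0 ≤ M) (v : n → E) : 0 ≤ matrixQuadForm v M := by
  obtain ⟨N, rfl⟩ := exists_eq_star_mul_self_of_nonneg hM
  rw [matrixQuadForm_star_mul_self]
  exact Finset.sum_nonneg fun _ _ => star_mul_self_nonneg _

theorem cstarMatrix_diag_nonneg (hM : 0 ≤ M) (k : n) : 0 ≤ M k k := by
  obtain ⟨N, rfl⟩ := exists_eq_star_mul_self_of_nonneg hM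
  rw [star_mul_self_apply_self]
  exact Finset.sum_nonneg fun i _ => star_mul_self_nonneg (N i k)

theorem cstarMatrix_eq_zero_of_diag_eq_zero (hM : 0 ≤ M) (h : ∀ k, M k k = 0) : M = 0 := by
  obtain ⟨N, rfl⟩ := exists_eq_star_mul_self_of_nonneg hM
  have hN : N = 0 := CStarMatrix.ext fun i k => by
    have h_sum := h k
    rw [star_mul_self_apply_self,
      Finset.sum_eq_zero_iff_of_nonneg fun i _ => star_mul_self_nonneg (N i k)] at h_sum
    exact (CStarRing.star_mul_self_eq_zero_iff _).1 (h_sum i (Finset.mem_univ i))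
  rw [hN, mul_zero]

theorem cstarMatrix_nonneg_of_isSelfAdjoint (hM : IsSelfAdjoint M)
    (h : ∀ v, 0 ≤ matrixQuadForm v M) : 0 ≤ M := by
  refine nonneg_of_forall_conjugate_eq_zero hM fun P hP h_nonpos => neg_eq_zero.1 ?_
  have h_diag (k : n) : (P * M * P) k k = matrixQuadForm (fun i => P i k) M := by
    rw [← star_mul_mul_apply_self_eq_matrixQuadForm, hP.isSelfAdjoint.star_eq]
  refine cstarMatrix_eq_zero_of_diag_eq_zero (neg_nonneg.2 h_nonpos) fun k =>
    le_antisymm ?_ (cstarMatrix_diag_nonneg (neg_nonneg.2 h_nonpos) k)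
  rw [CStarMatrix.neg_apply, neg_nonpos, h_diag]
  exact h _

theorem isSelfAdjoint_of_forall_matrixQuadForm_isSelfAdjoint
    (h : ∀ v, IsSelfAdjoint (matrixQuadForm v M)) : IsSelfAdjoint M := by
  let D : CStarMatrix n n E := Complex.I • (star M - M)
  have hD_sa : IsSelfAdjoint D := by
    rw [isSelfAdjoint_iff, star_smul, star_sub, star_star, Complex.star_def, Complex.conj_I,
      neg_smul, ← smul_neg, neg_sub]
  have hD_form (v : n → E) : matrixQuadForm v D = 0 := by
    rw [map_smul, map_sub, matrixQuadForm_star, (h v).star_eq, sub_self, smul_zero]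
  have hD : D = 0 := le_antisymm
    (neg_nonneg.1 <| cstarMatrix_nonneg_of_isSelfAdjoint hD_sa.neg fun v => by
      rw [map_neg, hD_form, neg_zero])
    (cstarMatrix_nonneg_of_isSelfAdjoint hD_sa fun v => (hD_form v).ge)
  exact sub_eq_zero.1 ((smul_eq_zero_iff_right Complex.I_ne_zero).1 hD)

theorem cstarMatrix_nonneg_iff : 0 ≤ M ↔ ∀ v, 0 ≤ matrixQuadForm v M :=
  ⟨matrixQuadForm_nonneg, fun h => cstarMatrix_nonneg_of_isSelfAdjoint
    (isSelfAdjoint_of_forall_matrixQuadForm_isSelfAdjoint fun v => (h v).isSelfAdjoint) h⟩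

end QuadraticForm

theorem exists_tendsto_ultrafilter_of_norm_le {ι E : Type*} [SeminormedAddCommGroup E]
    [ProperSpace E] (ω : Ultrafilter ι) {u : ι → E} {C : ℝ} (hu : ∀ i, ‖u i‖ ≤ C) :
    ∃ z, Tendsto u ω (𝓝 z) := by
  obtain ⟨z, -, hz⟩ := (isCompact_closedBall (0 : E) C).ultrafilter_le_nhds (ω.map u)
    (le_principal_iff.2 <| Filter.mem_map.2 <| Filter.univ_mem' fun i =>
      mem_closedBall_zero_iff.2 (hu i))
  exact ⟨z, hz⟩

section WeakOperatorTopology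

open ContinuousLinearMapWOT

theorem exists_tendsto_wot_of_norm_le {𝕜 H ι : Type*} [RCLike 𝕜] [NormedAddCommGroup H]
    [InnerProductSpace 𝕜 H] [CompleteSpace H] (ω : Ultrafilter ι) {T : ι → H →L[𝕜] H} {C : ℝ}
    (hT : ∀ i, ‖T i‖ ≤ C) : ∃ S : H →L[𝕜] H, Tendsto (fun i => ofCLM (T i)) ω (𝓝 (ofCLM S)) := by
  have h_bound (x y : H) (i : ι) : ‖inner 𝕜 (T i x) y‖ ≤ C * ‖x‖ * ‖y‖ :=
    (norm_inner_le_norm _ _).trans <|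
      mul_le_mul_of_nonneg_right ((T i).le_of_opNorm_le (hT i) x) (norm_nonneg y)
  choose L hL using fun x y => exists_tendsto_ultrafilter_of_norm_le ω (h_bound x y)
  let B : H →ₗ⋆[𝕜] H →ₗ[𝕜] 𝕜 := LinearMap.mk₂'ₛₗ (starRingEnd 𝕜) (RingHom.id 𝕜) L
    (fun x x' y => tendsto_nhds_unique (hL _ _) <|
      ((hL x y).add (hL x' y)).congr fun i => by rw [map_add, inner_add_left])
    (fun c x y => tendsto_nhds_unique (hL _ _) <|
      ((hL x y).const_mul (starRingEnd 𝕜 c)).congr fun i => by rw [map_smul, inner_smul_left])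
    (fun x y y' => tendsto_nhds_unique (hL _ _) <|
      ((hL x y).add (hL x y')).congr fun i => by rw [inner_add_right])
    (fun c x y => tendsto_nhds_unique (hL _ _) <|
      ((hL x y).const_mul c).congr fun i => by rw [inner_smul_right])
  let S := InnerProductSpace.continuousLinearMapOfBilin <| B.mkContinuous₂ C fun x y =>
    le_of_tendsto (hL x y).norm (Eventually.of_forall (h_bound x y))
  have hS (x y : H) : inner 𝕜 (S x) y = L x y :=
    InnerProductSpace.continuousLinearMapOfBilin_apply _ x y
  refine ⟨S, tendsto_iff_forall_inner_apply_tendsto.2 fun x y => ?_⟩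
  simp_rw [ofCLM_apply, ← inner_conj_symm y, hS]
  exact (RCLike.continuous_conj.tendsto _).comp (hL x y)

theorem clm_nonneg_iff_forall_inner_nonneg {H : Type*} [NormedAddCommGroup H]
    [InnerProductSpace ℂ H] {T : H →L[ℂ] H} : 0 ≤ T ↔ ∀ x, 0 ≤ ⟪T x, x⟫_ℂ := by
  simp only [T.nonneg_iff_isPositive, T.isPositive_iff_complex, Complex.nonneg_iff,
    Complex.ext_iff, RCLike.re_to_complex, Complex.ofReal_re, Complex.ofReal_im, true_and, and_comm]

variable {H : Type*} [NormedAddCommGroup H] [InnerProductSpace ℂ H] [CompleteSpace H]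

theorem isClosed_wot_nonneg : IsClosed {T : H →WOT[ℂ] H | 0 ≤ T.toCLM} := by
  have h_cont (x : H) : Continuous fun T : H →WOT[ℂ] H => ⟪T.toCLM x, x⟫_ℂ := by
    simp_rw [← inner_conj_symm _ x]
    exact Complex.continuous_conj.comp (ContinuousLinearMapWOT.continuous_iff.1 continuous_id x x)
  simp_rw [clm_nonneg_iff_forall_inner_nonneg, Set.ofPred_forall]
  exact isClosed_iInter fun x => isClosed_Ici.preimage (h_cont x)

theorem isClosed_wot_vonNeumannAlgebra (M : VonNeumannAlgebra H) :
    IsClosed {T : H →WOT[ℂ] H | T.toCLM ∈ M} := by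
  have h_centralizer : {T : H →WOT[ℂ] H | T.toCLM ∈ M} =
      Set.centralizer (toCLM ⁻¹' Set.centralizer (M : Set (H →L[ℂ] H))) := by
    ext T
    rw [Set.mem_ofPred_eq, ← SetLike.mem_coe]
    nth_rw 1 [← M.centralizer_centralizer]
    exact ⟨fun h S hS => toCLM_injective (h S.toCLM hS),
      fun h S hS => congrArg toCLM (h (ofCLM S) hS)⟩
  rw [h_centralizer]
  exact Set.isClosed_centralizer _

theorem cstarMatrix_nonneg_of_tendsto_wot {n ι : Type*} [Fintype n] {l : Filter ι} [l.NeBot]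
    {M : ι → CStarMatrix n n (H →L[ℂ] H)} {S : CStarMatrix n n (H →L[ℂ] H)}
    (hMS : ∀ i j, Tendsto (fun a => ofCLM (M a i j)) l (𝓝 (ofCLM (S i j))))
    (hM : ∀ a, 0 ≤ M a) : 0 ≤ S := by
  refine cstarMatrix_nonneg_iff.2 fun v => ?_
  have h_form (N : CStarMatrix n n (H →L[ℂ] H)) : ofCLM (matrixQuadForm v N) =
      ∑ i, ∑ j, ofCLM (star (v i)) * ofCLM (N i j) * ofCLM (v j) := by
    simp only [matrixQuadForm_apply, ← ofCLM_mul]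
    exact (map_sum (addEquiv (σ := RingHom.id ℂ)).symm _ _).trans <|
      Finset.sum_congr rfl fun i _ => map_sum (addEquiv (σ := RingHom.id ℂ)).symm _ _
  have h_tendsto : Tendsto (fun a => ofCLM (matrixQuadForm v (M a))) l
      (𝓝 (ofCLM (matrixQuadForm v S))) := by
    simp only [h_form]
    exact tendsto_finsetSum _ fun i _ => tendsto_finsetSum _ fun j _ =>
      ((hMS i j).const_mul _).mul_const _
  exact isClosed_wot_nonneg.mem_of_tendsto h_tendsto
    (Eventually.of_forall fun a => matrixQuadForm_nonneg (hM a) v)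

end WeakOperatorTopology

namespace Ultrapower

open ContinuousLinearMapWOT

variable {A ι : Type*} [CStarAlgebra A] {ω : Ultrafilter ι}

section WeakLimit

variable {H : Type*} [NormedAddCommGroup H] [InnerProductSpace ℂ H] [CompleteSpace H]

theorem tendsto_wot_limUnder (ψ : A →L[ℂ] H →L[ℂ] H) (a : lp (fun _ : ι => A) ∞) :
    Tendsto (fun i => ofCLM (ψ (a i))) ω (𝓝 (limUnder ω fun i => ofCLM (ψ (a i)))) := by
  obtain ⟨S, hS⟩ := exists_tendsto_wot_of_norm_le ω fun i =>
    ψ.le_of_opNorm_le_of_le le_rfl (bdd a i)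
  exact tendsto_nhds_limUnder ⟨_, hS⟩

variable (ω) in
/-- The map `ℓ^∞(ι, A) → B(H)` sending `(aᵢ)` to the limit of `ψ aᵢ` along `ω` in the weak operator
topology, for a bounded linear map `ψ : A → B(H)`. -/
noncomputable def lpWeakLimit (ψ : A →L[ℂ] H →L[ℂ] H) :
    lp (fun _ : ι => A) ∞ →ₗ[ℂ] H →L[ℂ] H where
  toFun a := (limUnder ω fun i => ofCLM (ψ (a i))).toCLM
  map_add' a b := by
    rw [← toCLM_add]
    refine congrArg toCLM (Tendsto.limUnder_eq ?_)
    refine ((tendsto_wot_limUnder ψ a).add (tendsto_wot_limUnder ψ b)).congr fun i => ?_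
    rw [lp.coeFn_add, Pi.add_apply, map_add, ofCLM_add]
  map_smul' c a := by
    rw [RingHom.id_apply, ← toCLM_smul]
    refine congrArg toCLM (Tendsto.limUnder_eq ?_)
    refine ((tendsto_wot_limUnder ψ a).const_smul c).congr fun i => ?_
    rw [lp.coeFn_smul, Pi.smul_apply, map_smul, ofCLM_smul]

theorem ultraNull_le_ker_lpWeakLimit (ψ : A →L[ℂ] H →L[ℂ] H) :
    ultraNull A ω ≤ LinearMap.ker (lpWeakLimit ω ψ) := by
  intro a (ha : Tendsto (fun i => ‖a i‖) ω (𝓝 0))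
  have h_norm : Tendsto (fun i => ψ (a i)) ω (𝓝 0) := by
    simpa only [map_zero, Function.comp_def] using
      (ψ.continuous.tendsto 0).comp (tendsto_zero_iff_norm_tendsto_zero.2 ha)
  exact congrArg toCLM ((continuous_ofCLM.tendsto 0).comp h_norm).limUnder_eq

variable (ω) in
/-- The map `A^ω → B(H)` induced by a bounded linear map `ψ : A → B(H)`: it sends the class of
`(aᵢ)` to the limit of `ψ aᵢ` along `ω` in the weak operator topology. -/
noncomputable def weakLimit (ψ : A →L[ℂ] H →L[ℂ] H) : Ultrapower A ω →ₗ[ℂ] H →L[ℂ] H :=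
  (ultraNull A ω).liftQ (lpWeakLimit ω ψ) (ultraNull_le_ker_lpWeakLimit ψ)

theorem tendsto_wot_weakLimit (ψ : A →L[ℂ] H →L[ℂ] H) (a : lp (fun _ : ι => A) ∞) :
    Tendsto (fun i => ofCLM (ψ (a i))) ω (𝓝 (ofCLM (weakLimit ω ψ (mk A ω a)))) :=
  tendsto_wot_limUnder ψ a

theorem weakLimit_diagonal (ψ : A →L[ℂ] H →L[ℂ] H) (a : A) :
    weakLimit ω ψ (diagonal A ω a) = ψ a :=
  ofCLM_injective <| tendsto_nhds_unique (tendsto_wot_weakLimit ψ (const ι a)) tendsto_const_nhds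

theorem weakLimit_mem {M : VonNeumannAlgebra H} {ψ : A →L[ℂ] H →L[ℂ] H} (hψ : ∀ a, ψ a ∈ M)
    (x : Ultrapower A ω) : weakLimit ω ψ x ∈ M := by
  obtain ⟨a, rfl⟩ := mk_surjective x
  exact (isClosed_wot_vonNeumannAlgebra M).mem_of_tendsto (tendsto_wot_weakLimit ψ a)
    (Eventually.of_forall fun i => hψ (a i))

end WeakLimit

variable [PartialOrder A] [StarOrderedRing A]

theorem exists_nonneg_lift {n : Type*} [Fintype n] {X : CStarMatrix n n (Ultrapower A ω)}
    (hX : 0 ≤ X) : ∃ c : n → n → lp (fun _ : ι => A) ∞, (∀ i j, mk A ω (c i j) = X i j) ∧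
      ∀ k, 0 ≤ CStarMatrix.ofMatrix fun i j => c i j k := by
  obtain ⟨Y, rfl⟩ := exists_eq_star_mul_self_of_nonneg hX
  choose d hd using fun i j => mk_surjective (Y i j)
  refine ⟨fun i j => ∑ m, star (d m i) * d m j, fun i j => ?_, fun k => ?_⟩
  · simp only [map_sum, mk_mul, mk_star, hd, CStarMatrix.mul_apply, CStarMatrix.star_apply]
  · let D : CStarMatrix n n A := CStarMatrix.ofMatrix fun i j => d i j k
    have hD : CStarMatrix.ofMatrix (fun i j => (∑ m, star (d m i) * d m j) k) = star D * D := by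
      ext i j
      simp only [CStarMatrix.mul_apply, CStarMatrix.star_apply]
      exact (congrFun (lp.coeFn_sum _ _) k).trans (Finset.sum_apply _ _ _)
    rw [hD]
    exact star_mul_self_nonneg D

variable {H : Type*} [NormedAddCommGroup H] [InnerProductSpace ℂ H] [CompleteSpace H]

variable (ω) in
/-- `Ultrapower.weakLimit` of a completely positive map, as a completely positive map. -/
noncomputable def weakLimitCP (φ : A →CP (H →L[ℂ] H)) : Ultrapower A ω →CP (H →L[ℂ] H) where
  toLinearMap := weakLimit ω ⟨φ.toLinearMap, map_continuous φ⟩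
  map_cstarMatrix_nonneg' k X hX := by
    obtain ⟨c, hc, h_nonneg⟩ := exists_nonneg_lift hX
    refine cstarMatrix_nonneg_of_tendsto_wot (l := (ω : Filter ι)) (fun i j => ?_)
      fun l => φ.map_cstarMatrix_nonneg _ (h_nonneg l)
    rw [CStarMatrix.map_apply, ← hc]
    exact tendsto_wot_weakLimit _ (c i j)

theorem weakLimitCP_diagonal (φ : A →CP (H →L[ℂ] H)) (a : A) :
    weakLimitCP ω φ (diagonal A ω a) = φ a :=
  weakLimit_diagonal _ a

theorem weakLimitCP_mem {M : VonNeumannAlgebra H} {φ : A →CP (H →L[ℂ] H)} (hφ : ∀ a, φ a ∈ M)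
    (x : Ultrapower A ω) : weakLimitCP ω φ x ∈ M :=
  weakLimit_mem hφ x

end Ultrapower

section CompletelyPositive

variable {A B C : Type*} [NonUnitalCStarAlgebra A] [PartialOrder A] [StarOrderedRing A]
  [NonUnitalCStarAlgebra B] [PartialOrder B] [StarOrderedRing B]

/-- The composition of completely positive maps. -/
def cpComp [NonUnitalCStarAlgebra C] [PartialOrder C] [StarOrderedRing C]
    (ψ : B →CP C) (φ : A →CP B) : A →CP C where
  toLinearMap := ψ.toLinearMap ∘ₗ φ.toLinearMap
  map_cstarMatrix_nonneg' k _ hM :=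
    ψ.map_cstarMatrix_nonneg' k _ (φ.map_cstarMatrix_nonneg' k _ hM)

variable [CStarAlgebra C] [PartialOrder C] [StarOrderedRing C]

/-- A completely positive map with values in a C⋆-subalgebra `S`, as a map to `S`. -/
def cpCodRestrict (φ : A →CP C) (S : StarSubalgebra ℂ C) [IsClosed (S : Set C)] [PartialOrder S]
    [StarOrderedRing S] (h : ∀ a, φ a ∈ S) : A →CP S where
  toLinearMap := φ.toLinearMap.codRestrict S.toSubmodule h
  map_cstarMatrix_nonneg' k M hM := by
    have h_inj : Function.Injective
        (CStarMatrix.mapₙₐ (n := Fin k) (S.subtype : S →⋆ₙₐ[ℂ] C)) := fun P Q hPQ =>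
      CStarMatrix.ext fun i j => Subtype.ext (congrFun₂ hPQ i j)
    exact nonneg_of_map_nonneg _ h_inj (φ.map_cstarMatrix_nonneg' k M hM)

end CompletelyPositive

namespace Ultrapower

variable {A ι : Type*} [CStarAlgebra A] [PartialOrder A] [StarOrderedRing A] {ω : Ultrafilter ι}

variable (A ω) in
/-- The weak operator limit along `ω` of the universal representation, as a map `A^ω → A**`. -/
noncomputable def toDoubleDual : Ultrapower A ω →CP DoubleDual A :=
  cpCodRestrict
    (weakLimitCP ω (CompletelyPositiveMapClass.toCompletelyPositiveLinearMap (universalRep A)))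
    (envelopingVonNeumannAlgebra A).toStarSubalgebra (weakLimitCP_mem DoubleDual.universalRep_mem)

theorem toDoubleDual_diagonal (a : A) :
    toDoubleDual A ω (diagonal A ω a) = DoubleDual.inclusion A a :=
  Subtype.ext (weakLimitCP_diagonal _ a)

theorem isUCP_toDoubleDual : IsUCP (toDoubleDual A ω) := by
  have h_one := toDoubleDual_diagonal (ω := ω) (1 : A)
  rwa [map_one (diagonal A ω), map_one (DoubleDual.inclusion A)] at h_one

end Ultrapower

namespace RelativelyWeaklyInjective

theorem of_isUCP {A B C : Type*} [CStarAlgebra A] [PartialOrder A] [StarOrderedRing A]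
    [CStarAlgebra B] [PartialOrder B] [StarOrderedRing B]
    [CStarAlgebra C] [PartialOrder C] [StarOrderedRing C]
    {j : A →⋆ₙₐ[ℂ] B} {k : A →⋆ₙₐ[ℂ] C} (hk : RelativelyWeaklyInjective k) {Φ : B →CP C}
    (hΦ : IsUCP Φ) (hΦj : ∀ a, Φ (j a) = k a) : RelativelyWeaklyInjective j := by
  obtain ⟨Ψ, hΨ, hΨk⟩ := hk
  exact ⟨cpComp Ψ Φ, (congrArg Ψ hΦ).trans hΨ, fun a => (congrArg Ψ (hΦj a)).trans (hΨk a)⟩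

theorem diagonal {A ι : Type*} [CStarAlgebra A] [PartialOrder A] [StarOrderedRing A]
    (ω : Ultrafilter ι) :
    RelativelyWeaklyInjective (Ultrapower.diagonal A ω).toNonUnitalStarAlgHom :=
  ⟨Ultrapower.toDoubleDual A ω, Ultrapower.isUCP_toDoubleDual, Ultrapower.toDoubleDual_diagonal⟩

end RelativelyWeaklyInjective

theorem mainTheorem6 {A : Type*} [CStarAlgebra A] [PartialOrder A] [StarOrderedRing A]
    {ι : Type*} (ω : Ultrafilter ι) (hω : ∀ i : ι, ω ≠ pure i) :
    (∀ {B : Type*} [CStarAlgebra B] [PartialOrder B] [StarOrderedRing B]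
        (j : A →⋆ₙₐ[ℂ] B), Function.Injective j →
        (∃ Φ : B →CP Ultrapower A ω, IsUCP Φ ∧ ∀ a : A, Φ (j a) = Ultrapower.diagonal A ω a) →
        RelativelyWeaklyInjective j) ∧
      RelativelyWeaklyInjective (Ultrapower.diagonal A ω).toNonUnitalStarAlgHom := by
  refine ⟨fun j _ ⟨Φ, hΦ, hΦj⟩ => ?_, .diagonal ω⟩
  exact (RelativelyWeaklyInjective.diagonal ω).of_isUCP hΦ hΦj
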